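/- Let $p,q\ge 0$ be integers, $n=p+q$, and let $\mathcal{C}\ell(p,q)$ be the complex Clifford algebra with identity $e$ and generators $e^1,\dots,e^n$ satisfying $e^ae^b+e^be^a=2\eta^{ab}e$, where $\eta=\mathrm{diag}(1,\dots,1,-1,\dots,-1)$ has $p$ entries $+1$ followed by $q$ entries $-1$. The products $e^{a_1\dots a_k}=e^{a_1}\cdots e^{a_k}$, $1\le a_1<\dots<a_k\le n$, $0\le k\le n$ (with $e$ for $k=0$), form a basis, so each $U$ is uniquely $U=\sum_{k=0}^n\overset{k}{U}$ with $\overset{k}{U}=\sum_{a_1<\dots<a_k}u_{a_1\dots a_k}e^{a_1\dots a_k}$, $u_{a_1\dots a_k}\in\mathbb{C}$. Define - the grade involution $U^{\curlywedge}=\sum_k(-1)^k\overset{k}{U}$; - the reverse $U^{\sim}=\sum_k(-1)^{k(k-1)/2}\overset{k}{U}$; - the complex conjugate $\bar U$, obtained by replacing each coefficient $u_{a_1\dots a_k}$ by its complex conjugate; - the pseudo-Hermitian conjugate $U^{\ddagger}=(\bar U)^{\sim}$; - the Hermitian conjugate $U^{\dagger}=(e^{1\dots p})^{-1}U^{\ddagger}e^{1\dots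 p}$ if $p$ is odd, and $U^{\dagger}=(e^{1\dots p})^{-1}(U^{\ddagger})^{\curlywedge}e^{1\dots p}$ if $p$ is even (with $e^{1\dots p}=e$ if $p=0$). Let $\operatorname{Det}U=\det\gamma(U)\in\mathbb{C}$, where $\gamma$ is a faithful unital $\mathbb{C}$-linear matrix representation of $\mathcal{C}\ell(p,q)$ of minimal order among all such representations. Theorem. $\operatorname{Det}U$ does not depend on the choice of $\gamma$, and 1. $\operatorname{Det}(UV)=\operatorname{Det}(U)\operatorname{Det}(V)$ and $\operatorname{Det}(\alpha U)=\alpha^{2^{\lfloor (n+1)/2\rfloor}}\operatorname{Det}(U)$ for all $U,V\in\mathcal{C}\ell(p,q)$, $\alpha\in\mathbb{C}$. 2. $U\in\mathcal{C}\ell(p,q)$ is invertible if and only if $\operatorname{Det}U\ne0$. 3. $\operatorname{Det}(U^{-1})=(\operatorname{Det}U)^{-1}$ for every invertible $U$. 4. $\operatorname{Det}(U^{-1}VU)=\operatorname{Det}(V)$ for every $V$ and every invertible $U$. 5. For every $U$: $\operatorname{Det}(U)=\operatorname{Det}(U^{\curlywedge})=\operatorname{Det}(U^{\sim})=\overline{\operatorname{Det}(\bar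 U)}=\overline{\operatorname{Det}(U^{\ddagger})}=\overline{\operatorname{Det}(U^{\dagger})}$. -/

import Mathlib

noncomputable section

namespace CliffordDet

/-- The diagonal entries of `η`: `p` entries `+1`, followed by `q` entries `-1`. -/
def eta (p q : ℕ) (a : Fin (p + q)) : ℂ := if (a : ℕ) < p then 1 else -1

/-- The diagonal quadratic form `x ↦ ∑ a, η^{aa} x_a ^ 2` on `ℂ^{p+q}`. -/
def form (p q : ℕ) : QuadraticForm ℂ (Fin (p + q) → ℂ) :=
  QuadraticMap.weightedSumSquares ℂ (eta p q)

/-- The complex Clifford algebra `Cl(p,q)`. -/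
abbrev Cl (p q : ℕ) : Type := CliffordAlgebra (form p q)

/-- The generators `e^a`. -/
def gen (p q : ℕ) (a : Fin (p + q)) : Cl p q :=
  CliffordAlgebra.ι (form p q) (Pi.single a 1)

/-- The product `e^{a_1 … a_k} = e^{a_1} ⋯ e^{a_k}` over the elements `a_1 < … < a_k` of `A`
(the identity element `e` if `A` is empty). -/
def blade (p q : ℕ) (A : Finset (Fin (p + q))) : Cl p q :=
  ((A.sort (· ≤ ·)).map (gen p q)).prod

/-- The defining relations `e^a e^b + e^b e^a = 2 η^{ab} e`. -/
theorem gen_mul_gen_add (p q : ℕ) (a b : Fin (p + q)) :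
    gen p q a * gen p q b + gen p q b * gen p q a
      = algebraMap ℂ (Cl p q) (2 * Matrix.diagonal (eta p q) a b) := by
  rw [gen, gen, CliffordAlgebra.ι_mul_ι_add_swap]
  congr 1
  simp only [QuadraticMap.polar, form, QuadraticMap.weightedSumSquares_apply, Pi.add_apply,
    smul_eq_mul]
  by_cases h : a = b
  · subst h
    have key : ∀ c : ℂ, ∑ i, eta p q i * ((Pi.single a c : Fin (p + q) → ℂ) i
        * (Pi.single a c : Fin (p + q) → ℂ) i) = eta p q a * (c * c) := fun c => by
      rw [Finset.sum_eq_single a] <;> simp +contextual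
    have h2 : ∀ i, (Pi.single a (1 : ℂ) : Fin (p + q) → ℂ) i + (Pi.single a (1 : ℂ) :
        Fin (p + q) → ℂ) i = (Pi.single a (2 : ℂ) : Fin (p + q) → ℂ) i := fun i => by
      rw [← Pi.add_apply, ← Pi.single_add]; norm_num
    simp only [h2, key, Matrix.diagonal_apply_eq]
    ring
  · rw [Matrix.diagonal_apply_ne _ h, ← Finset.sum_sub_distrib, ← Finset.sum_sub_distrib, mul_zero]
    refine Finset.sum_eq_zero fun i _ => ?_
    by_cases h1 : i = a
    · subst h1; simp [h]
    · simp [h1]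

theorem equivExterior_prod (p q : ℕ) (l : List (Fin (p + q))) (hl : l.Nodup) :
    CliffordAlgebra.equivExterior (form p q) (l.map (gen p q)).prod
      = (l.map fun a => ExteriorAlgebra.ι ℂ (Pi.single a 1 : Fin (p + q) → ℂ)).prod := by
  have hcontr : ∀ (d : Module.Dual ℂ (Fin (p + q) → ℂ)) (l : List (Fin (p + q))),
      (∀ b ∈ l, d (Pi.single b 1) = 0) →
      CliffordAlgebra.contractLeft (Q := (0 : QuadraticForm ℂ (Fin (p + q) → ℂ))) d
        (l.map fun a => ExteriorAlgebra.ι ℂ (Pi.single a 1 : Fin (p + q) → ℂ)).prod = 0 := by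
    intro d l
    induction l with
    | nil => intro _; simp
    | cons b l ih =>
      intro h
      rw [List.map_cons, List.prod_cons]
      erw [CliffordAlgebra.contractLeft_ι_mul]
      rw [h b (by simp), ih fun c hc => h c (by simp [hc])]
      simp
  induction l with
  | nil => simp
  | cons a l ih =>
    rw [List.nodup_cons] at hl
    have ih := ih hl.2
    rw [CliffordAlgebra.equivExterior, CliffordAlgebra.changeFormEquiv_apply] at ih ⊢
    rw [List.map_cons, List.prod_cons, List.map_cons, List.prod_cons, gen,
      CliffordAlgebra.changeForm_ι_mul, ih, hcontr, sub_zero]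
    · intro b hb
      have hab : a ≠ b := fun h => hl.1 (h ▸ hb)
      simp only [QuadraticMap.associated_apply, neg_apply, form,
        QuadraticMap.weightedSumSquares_apply, Pi.add_apply, smul_eq_mul]
      rw [← Finset.sum_neg_distrib, ← Finset.sum_neg_distrib, ← Finset.sum_neg_distrib,
        ← Finset.sum_sub_distrib, ← Finset.sum_sub_distrib]
      rw [Finset.sum_eq_zero, smul_zero]
      intro i _
      by_cases h1 : i = a
      · subst h1; simp [hab]
      · simp [h1]

theorem equivExterior_blade (p q : ℕ) (A : Finset (Fin (p + q))) :
    CliffordAlgebra.equivExterior (form p q) (blade p q A)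
      = (Pi.basisFun ℂ (Fin (p + q))).ExteriorAlgebra A := by
  rw [blade, equivExterior_prod p q _ (A.sort_nodup _), ExteriorAlgebra.basis_apply_ofCard _ rfl,
    ExteriorAlgebra.ιMulti_family, ExteriorAlgebra.ιMulti_apply]
  congr 1
  refine List.ext_getElem (by simp) fun i h1 h2 => ?_
  simp [Set.powersetCard.ofFinEmbEquiv_symm_apply, Finset.orderEmbOfFin_apply]

/-- The basis of `Cl(p,q)` formed by the identity element and the products `e^{a_1 … a_k}`. -/
def bladeBasis (p q : ℕ) : Module.Basis (Finset (Fin (p + q))) ℂ (Cl p q) :=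
  (Pi.basisFun ℂ (Fin (p + q))).ExteriorAlgebra.map
    (CliffordAlgebra.equivExterior (form p q)).symm

@[simp]
theorem bladeBasis_apply (p q : ℕ) (A : Finset (Fin (p + q))) :
    bladeBasis p q A = blade p q A := by
  rw [bladeBasis, Module.Basis.map_apply, ← equivExterior_blade, LinearEquiv.symm_apply_apply]

variable {p q : ℕ}

/-- The coefficient `u_{a_1 … a_k}` of `e^{a_1 … a_k}` in `U`, where `A = {a_1 < … < a_k}`. -/
def coeff (U : Cl p q) (A : Finset (Fin (p + q))) : ℂ := (bladeBasis p q).repr U A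

theorem sum_coeff_smul_blade (U : Cl p q) : ∑ A, coeff U A • blade p q A = U := by
  simpa [coeff] using (bladeBasis p q).sum_repr U

/-- The rank `k` part of `U`. -/
def rankPart (k : ℕ) (U : Cl p q) : Cl p q :=
  ∑ A ∈ Finset.powersetCard k Finset.univ, coeff U A • blade p q A

/-- Complex conjugation: the coefficients are conjugated. -/
def complexConj (U : Cl p q) : Cl p q :=
  ∑ A, (starRingEnd ℂ) (coeff U A) • blade p q A

/-- The reverse: the rank `k` part is multiplied by `(-1)^{k(k-1)/2}`. -/
def rev (U : Cl p q) : Cl p q :=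
  ∑ k ∈ Finset.range (p + q + 1), (-1 : ℂ) ^ (k * (k - 1) / 2) • rankPart k U

/-- The grade involution: the rank `k` part is multiplied by `(-1)^k`. -/
def gradeInv (U : Cl p q) : Cl p q :=
  ∑ k ∈ Finset.range (p + q + 1), (-1 : ℂ) ^ k • rankPart k U

/-- Pseudo-Hermitian conjugation: complex conjugation followed by the reverse. -/
def pseudoHermitianConj (U : Cl p q) : Cl p q := rev (complexConj U)

/-- `e^{1 … p}`, the product of the generators with square `+1`. -/
def posBlade (p q : ℕ) : Cl p q := blade p q (Finset.univ.filter fun a => (a : ℕ) < p)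

/-- The products `e^{a_1 … a_k}` are invertible, so `Ring.inverse` below is the true inverse. -/
theorem isUnit_blade (A : Finset (Fin (p + q))) : IsUnit (blade p q A) := by
  have hsq : ∀ a, gen p q a * gen p q a = algebraMap ℂ (Cl p q) (eta p q a) := fun a => by
    have h := gen_mul_gen_add p q a a
    rw [Matrix.diagonal_apply_eq, map_mul, ← two_mul, map_ofNat] at h
    have h2 : (2 : ℂ) • (gen p q a * gen p q a)
        = (2 : ℂ) • algebraMap ℂ (Cl p q) (eta p q a) := by
      simpa only [two_smul, two_mul] using h
    exact smul_right_injective _ (two_ne_zero' ℂ) h2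
  have heta : ∀ a, eta p q a * eta p q a = 1 := fun a => by unfold eta; split_ifs <;> norm_num
  have hgen : ∀ a, IsUnit (gen p q a) := fun a => by
    refine ⟨⟨gen p q a, eta p q a • gen p q a, ?_, ?_⟩, rfl⟩
    · rw [mul_smul_comm, hsq, Algebra.smul_def, ← map_mul, heta, map_one]
    · rw [smul_mul_assoc, hsq, Algebra.smul_def, ← map_mul, heta, map_one]
  have hl : ∀ l : List (Fin (p + q)), IsUnit (l.map (gen p q)).prod := fun l => by
    induction l with
    | nil => simp
    | cons a l ih => rw [List.map_cons, List.prod_cons]; exact (hgen a).mul ih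
  exact hl _

/-- Hermitian conjugation: `(e^{1…p})⁻¹ U^‡ e^{1…p}` if `p` is odd, and the same with the grade
involution of `U^‡` in place of `U^‡` if `p` is even. -/
def hermitianConj (U : Cl p q) : Cl p q :=
  if Odd p then Ring.inverse (posBlade p q) * pseudoHermitianConj U * posBlade p q
  else Ring.inverse (posBlade p q) * gradeInv (pseudoHermitianConj U) * posBlade p q

/-- A faithful matrix representation of `Cl(p,q)` of order `N` exists. -/
def HasFaithfulRep (p q N : ℕ) : Prop :=
  ∃ γ : Cl p q →ₐ[ℂ] Matrix (Fin N) (Fin N) ℂ, Function.Injective γ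

theorem exists_hasFaithfulRep (p q : ℕ) : ∃ N, HasFaithfulRep p q N := by
  let b := (bladeBasis p q).reindex (Fintype.equivFin _)
  exact ⟨_, Algebra.leftMulMatrix b, Algebra.leftMulMatrix_injective b⟩

open Classical in
/-- The minimal order of a faithful matrix representation of `Cl(p,q)`. -/
def minOrder (p q : ℕ) : ℕ := Nat.find (exists_hasFaithfulRep p q)

open Classical in
theorem hasFaithfulRep_minOrder (p q : ℕ) : HasFaithfulRep p q (minOrder p q) :=
  Nat.find_spec (exists_hasFaithfulRep p q)

/-- A faithful matrix representation of minimal order. -/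
def minRep (p q : ℕ) : Cl p q →ₐ[ℂ] Matrix (Fin (minOrder p q)) (Fin (minOrder p q)) ℂ :=
  (hasFaithfulRep_minOrder p q).choose

/-- The determinant of `U`: the determinant of its matrix in a faithful matrix representation of
minimal order. -/
def Det (U : Cl p q) : ℂ := (minRep p q U).det

end CliffordDet

end

/-! The whole theorem follows from a trace formula: in every faithful representation `γ` of minimal
order `N`, `tr γ(U) = N * coeff U ∅`. Over `ℂ` the traces of all powers of a matrix determine its
determinant (`det_eq_of_trace_pow_eq`), so `Det U` depends only on the identity coefficients of the
powers `U ^ k`. This gives independence of `γ`. Grade involution and reverse commute with powers and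
fix that coefficient; complex conjugation commutes with powers and conjugates it. Hermitian
conjugation then costs only a similarity.

For the trace formula, a nontrivial product `e^A` anticommutes with some invertible generator and so
has trace zero, except the central `e^{1…n}` for odd `n`. There, minimality enters. The central
idempotents `(1 ± w) / 2`, with `w` a multiple of `e^{1…n}` and `w ^ 2 = 1`, cut the algebra into
two ideals of equal dimension, so faithfulness forces both ranks to be at least `2 ^ ((n - 1) / 2)`.
Pauli-type matrices give a faithful representation of order `2 ^ ((n + 1) / 2)` (integer division),
so at minimal order the two ranks coincide, and their difference `tr γ(w)` vanishes. -/

/-! ### Traces of powers determine the determinant -/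

namespace Matrix

open Polynomial

variable {ι : Type*} [Fintype ι] [DecidableEq ι]

/-- The polynomial `tr (A ^ j * adj (1 - X A))`. -/
noncomputable def traceAdj (A : Matrix ι ι ℂ) (j : ℕ) : ℂ[X] :=
  trace ((A ^ j).map C * adjugate (1 - (X : ℂ[X]) • A.map C))

/-- Comes from `adj (1 - X A) = det (1 - X A) + X A adj (1 - X A)`. Iterated, it identifies
`traceAdj A j` with `charpolyRev` times the generating series of `tr (A ^ (i + j))`, without using
power series. -/
theorem traceAdj_succ (A : Matrix ι ι ℂ) (j : ℕ) :
    traceAdj A j = A.charpolyRev * C (trace (A ^ j)) + X * traceAdj A (j + 1) := by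
  have h := mul_adjugate (1 - (X : ℂ[X]) • A.map C)
  rw [sub_mul, one_mul, sub_eq_iff_eq_add] at h
  have hp : (A ^ (j + 1)).map C = (A ^ j).map C * A.map (C : ℂ →+* ℂ[X]) := by
    rw [pow_succ, Matrix.map_mul]
  have ht : trace ((A ^ j).map (C : ℂ →+* ℂ[X])) = C (trace (A ^ j)) := by
    simp [trace]
  rw [traceAdj, h, mul_add, trace_add, traceAdj, hp, charpolyRev]
  simp [ht, mul_assoc]

theorem eval_charpolyRev_eq (A : Matrix ι ι ℂ) (t : ℂ) :
    A.charpolyRev.eval t = det (1 - t • A) := by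
  rw [charpolyRev, eval_det]
  congr 1
  ext i j
  simp [one_apply, mul_comm]

theorem eval_traceAdj (A : Matrix ι ι ℂ) (j : ℕ) (t : ℂ) :
    (traceAdj A j).eval t = trace (A ^ j * adjugate (1 - t • A)) := by
  have h1 : (1 - (X : ℂ[X]) • A.map C).map (evalRingHom t) = 1 - t • A := by
    ext i j
    rcases eq_or_ne i j with rfl | hij
    · simp only [map_apply, sub_apply, smul_apply, smul_eq_mul, one_apply_eq, coe_evalRingHom,
        eval_sub, eval_mul, eval_X, eval_C, eval_one]
    · simp only [map_apply, sub_apply, smul_apply, smul_eq_mul, one_apply_ne hij, coe_evalRingHom,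
        eval_sub, eval_mul, eval_X, eval_C, eval_zero]
  have h2 : ((A ^ j).map C).map (evalRingHom t) = A ^ j := by
    ext i j
    simp
  rw [← h1, ← RingHom.mapMatrix_apply, ← RingHom.map_adjugate, RingHom.mapMatrix_apply]
  rw [show A ^ j * _ = _ from congrArg (· * _) h2.symm]
  rw [← Matrix.map_mul, traceAdj, trace, trace, eval_finsetSum]
  rfl

/-- Jacobi's formula for `det (1 - X A)`. Multiplying by the nonzero polynomial `charpolyRev`
reduces it to points `t` where `1 - t A` is invertible. -/
theorem derivative_charpolyRev (A : Matrix ι ι ℂ) :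
    derivative A.charpolyRev = - traceAdj A 1 := by
  have hne : A.charpolyRev ≠ 0 := fun h => by
    have := eval_charpolyRev (M := A)
    simp [h] at this
  refine mul_right_cancel₀ hne (Polynomial.funext fun t => ?_)
  rw [eval_mul, eval_mul]
  by_cases ht : A.charpolyRev.eval t = 0
  · simp [ht]
  congr 1
  have hu : IsUnit (det (1 - t • A)) := by
    rw [← eval_charpolyRev_eq]; exact isUnit_iff_ne_zero.mpr ht
  -- Factoring `1 - t A` out of `1 - (h + t) A` moves the base point to `0`, where the derivative of
  -- `det (1 + X M)` is `tr M`.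
  have hcomp : A.charpolyRev.comp (X + C t)
      = C (det (1 - t • A)) * det (1 + (X : ℂ[X]) • (-((1 - t • A)⁻¹ * A)).map C) := by
    refine Polynomial.funext fun h => ?_
    have h1 : (1 - (h + t) • A) = (1 - t • A) * (1 - h • ((1 - t • A)⁻¹ * A)) := by
      rw [mul_sub, mul_one, mul_smul_comm, ← mul_assoc, mul_nonsing_inv _ hu, one_mul, add_smul]
      abel
    have h2 : (1 + (X : ℂ[X]) • (-((1 - t • A)⁻¹ * A)).map C)
        = 1 - (X : ℂ[X]) • ((1 - t • A)⁻¹ * A).map C := by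
      rw [Matrix.map_neg _ (map_neg C), smul_neg, ← sub_eq_add_neg]
    rw [eval_comp, eval_mul, h2, ← charpolyRev, eval_charpolyRev_eq, eval_charpolyRev_eq]
    simp only [eval_add, eval_X, eval_C]
    rw [h1, det_mul]
  have hd := congrArg (fun f => eval 0 (derivative f)) hcomp
  simp only [derivative_comp, derivative_mul, derivative_C, zero_mul, zero_add, eval_mul, eval_C,
    derivative_det_one_add_X_smul, eval_comp, derivative_add, derivative_X, add_zero, eval_add,
    eval_X, eval_one] at hd
  rw [one_mul] at hd
  rw [hd, eval_neg, eval_traceAdj, pow_one, inv_def, trace_neg, Ring.inverse_eq_inv', smul_mul_assoc,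
    trace_smul, smul_eq_mul, trace_mul_comm, mul_neg, ← mul_assoc, mul_inv_cancel₀ hu.ne_zero,
    one_mul]

/-- Matrices whose powers have the same traces have the same determinant. -/
theorem det_eq_of_trace_pow_eq {A B : Matrix ι ι ℂ}
    (h : ∀ k, trace (A ^ k) = trace (B ^ k)) : det A = det B := by
  -- The two quotients `traceAdj / charpolyRev` have the same expansion at `0`, so the cross
  -- difference vanishes to every order.
  have hdvd : ∀ k j, (X : ℂ[X]) ^ k ∣
      traceAdj A j * B.charpolyRev - traceAdj B j * A.charpolyRev := by
    intro k
    induction k with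
    | zero => simp
    | succ k ih =>
      intro j
      have : traceAdj A j * B.charpolyRev - traceAdj B j * A.charpolyRev
          = X * (traceAdj A (j + 1) * B.charpolyRev - traceAdj B (j + 1) * A.charpolyRev) := by
        rw [traceAdj_succ A j, traceAdj_succ B j, h]
        ring
      rw [this, pow_succ']
      exact mul_dvd_mul_left _ (ih _)
  have hzero : ∀ f : ℂ[X], (∀ k, (X : ℂ[X]) ^ k ∣ f) → f = 0 := fun f hf => by
    ext n
    exact X_pow_dvd_iff.mp (hf (n + 1)) n n.lt_succ_self
  -- Equality of logarithmic derivatives, with denominators cleared.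
  have hw : derivative A.charpolyRev * B.charpolyRev
      = A.charpolyRev * derivative B.charpolyRev := by
    have := hzero _ fun k => hdvd k 1
    rw [derivative_charpolyRev, derivative_charpolyRev]
    linear_combination -this
  have hrev : A.charpolyRev = B.charpolyRev := by
    rw [← sub_eq_zero]
    refine hzero _ fun k => ?_
    have hf : derivative (A.charpolyRev - B.charpolyRev) * B.charpolyRev
        = (A.charpolyRev - B.charpolyRev) * derivative B.charpolyRev := by
      rw [derivative_sub]
      linear_combination hw
    have h0 : (A.charpolyRev - B.charpolyRev).coeff 0 = 0 := by
      rw [coeff_zero_eq_eval_zero]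
      simp
    generalize A.charpolyRev - B.charpolyRev = f at hf h0
    have hB : B.charpolyRev.coeff 0 = 1 := by rw [coeff_zero_eq_eval_zero, eval_charpolyRev]
    -- The order of vanishing of `f` at `0` keeps growing: if `f = X ^ (k + 1) * g`, the lowest term
    -- of `hf` reads `(k + 1) * g(0) = 0`.
    have key : ∀ k, (X : ℂ[X]) ^ (k + 1) ∣ f := by
      intro k
      induction k with
      | zero => simpa [X_dvd_iff] using h0
      | succ k ih =>
        obtain ⟨g, rfl⟩ := ih
        rw [pow_succ]
        refine mul_dvd_mul_left _ (X_dvd_iff.mpr ?_)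
        have h1 : X ^ k * ((k + 1 : ℂ[X]) * g * B.charpolyRev)
            = X ^ k * (X * (g * derivative B.charpolyRev - derivative g * B.charpolyRev)) := by
          simp only [derivative_mul, derivative_X_pow, map_natCast] at hf
          push_cast at hf
          linear_combination hf
        have h2 := congrArg (fun f => f.coeff 0) (mul_left_cancel₀ (pow_ne_zero k X_ne_zero) h1)
        simp only [mul_coeff_zero, hB, coeff_X_zero, zero_mul, mul_one, coeff_add, coeff_one_zero,
          coeff_natCast_ite, if_true] at h2
        exact (mul_eq_zero.mp h2).resolve_left (Nat.cast_add_one_ne_zero k)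
    exact (pow_dvd_pow _ k.le_succ).trans (key k)
  have hcard : A.charpoly.natDegree = B.charpoly.natDegree := by
    simp [charpoly_natDegree_eq_dim]
  have hcoeff : A.charpoly.coeff 0 = B.charpoly.coeff 0 := by
    have h0 := congrArg (fun f => f.coeff A.charpoly.natDegree) hrev
    simp only [← reverse_charpoly, coeff_reverse] at h0
    rw [revAt_le le_rfl, hcard, revAt_le le_rfl] at h0
    simpa using h0
  rw [det_eq_sign_charpoly_coeff, det_eq_sign_charpoly_coeff, hcoeff]

end Matrix

/-! ### Multiplication of the basis products -/

noncomputable section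
namespace CliffordDet

variable {p q : ℕ}

theorem eta_mul_self (a : Fin (p + q)) : eta p q a * eta p q a = 1 := by
  unfold eta; split_ifs <;> norm_num

theorem gen_mul_self (a : Fin (p + q)) :
    gen p q a * gen p q a = algebraMap ℂ (Cl p q) (eta p q a) := by
  have h := gen_mul_gen_add p q a a
  rw [Matrix.diagonal_apply_eq, map_mul, ← two_mul, map_ofNat] at h
  have h2 : (2 : ℂ) • (gen p q a * gen p q a)
      = (2 : ℂ) • algebraMap ℂ (Cl p q) (eta p q a) := by
    simpa only [two_smul, two_mul] using h
  exact smul_right_injective _ (two_ne_zero' ℂ) h2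

theorem gen_mul_gen_of_ne {a b : Fin (p + q)} (h : a ≠ b) :
    gen p q a * gen p q b = -(gen p q b * gen p q a) := by
  have := gen_mul_gen_add p q a b
  rw [Matrix.diagonal_apply_ne _ h, mul_zero, map_zero] at this
  exact eq_neg_of_add_eq_zero_left this

/-- Each letter other than `a` contributes a sign; `length + count` has the parity of `length -
count`. -/
theorem gen_mul_prod (a : Fin (p + q)) (l : List (Fin (p + q))) :
    gen p q a * (l.map (gen p q)).prod
      = (-1 : ℂ) ^ (l.length + l.count a) • ((l.map (gen p q)).prod * gen p q a) := by
  induction l with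
  | nil => simp
  | cons b l ih =>
    rw [List.map_cons, List.prod_cons, List.length_cons, List.count_cons]
    by_cases h : a = b
    · subst h
      rw [mul_assoc _ _ (gen p q a), ← mul_smul_comm]
      simp only [beq_self_eq_true, if_true]
      rw [show l.length + 1 + (l.count a + 1) = l.length + l.count a + 2 by ring, pow_add, ih]
      simp
    · rw [← mul_assoc, gen_mul_gen_of_ne h, neg_mul, mul_assoc, ih, if_neg (by simpa using Ne.symm h),
        add_zero, add_right_comm, pow_succ]
      simp [mul_assoc]

theorem gen_mul_blade (a : Fin (p + q)) (A : Finset (Fin (p + q))) :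
    gen p q a * blade p q A
      = (-1 : ℂ) ^ (A.card + if a ∈ A then 1 else 0) • (blade p q A * gen p q a) := by
  rw [blade, gen_mul_prod, Finset.length_sort,
    List.Nodup.count (A.sort_nodup _)]
  simp

theorem prod_perm {l₁ l₂ : List (Fin (p + q))} (h : l₁.Perm l₂) (hl : l₁.Nodup) :
    (l₁.map (gen p q)).prod = (l₂.map (gen p q)).prod ∨
      (l₁.map (gen p q)).prod = -(l₂.map (gen p q)).prod := by
  induction h with
  | nil => simp
  | cons a _ ih =>
    simp only [List.map_cons, List.prod_cons]
    rcases ih (List.nodup_cons.mp hl).2 with h | h <;> simp [h]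
  | swap a b l =>
    right
    have hab : b ≠ a := by
      rintro rfl; simp at hl
    simp only [List.map_cons, List.prod_cons]
    rw [← mul_assoc, gen_mul_gen_of_ne hab, neg_mul, mul_assoc]
  | trans h₁ _ ih₁ ih₂ =>
    rcases ih₁ hl with h | h <;> rcases ih₂ (h₁.nodup_iff.mp hl) with h' | h' <;> simp [h, h']

/-- `B` is the symmetric difference of `A` and `{a}`. The sign collects the reordering and, if `a ∈
A`, the square of `e^a`. -/
theorem exists_gen_mul_blade (a : Fin (p + q)) (A : Finset (Fin (p + q))) :
    ∃ B, gen p q a * blade p q A = blade p q B ∨ gen p q a * blade p q A = -blade p q B := by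
  by_cases h : a ∈ A
  · refine ⟨A.erase a, ?_⟩
    have hp : (A.sort (· ≤ ·)).Perm (a :: (A.erase a).sort (· ≤ ·)) := by
      refine (List.perm_ext_iff_of_nodup (A.sort_nodup _) ?_).mpr fun b => ?_
      · simp [Finset.sort_nodup]
      · by_cases hb : b = a <;> simp [hb, h]
    have heta : eta p q a = 1 ∨ eta p q a = -1 := by unfold eta; split_ifs <;> simp
    have hm : gen p q a * (((a :: (A.erase a).sort (· ≤ ·))).map (gen p q)).prod
        = eta p q a • blade p q (A.erase a) := by
      rw [List.map_cons, List.prod_cons, ← mul_assoc, gen_mul_self, Algebra.smul_def, blade]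
    rcases prod_perm hp (A.sort_nodup _) with h' | h' <;> rcases heta with he | he <;>
      rw [blade, h'] <;>
      simp only [mul_neg, hm, he, one_smul, neg_smul, neg_neg, true_or, or_true]
  · refine ⟨insert a A, ?_⟩
    have hp : (a :: A.sort (· ≤ ·)).Perm ((insert a A).sort (· ≤ ·)) := by
      refine (List.perm_ext_iff_of_nodup ?_ (Finset.sort_nodup _ _)).mpr fun b => ?_
      · simp [Finset.sort_nodup, h]
      · simp
    simpa [blade] using prod_perm hp (by simp [Finset.sort_nodup, h])

theorem exists_blade_mul_blade (A B : Finset (Fin (p + q))) :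
    ∃ C, blade p q A * blade p q B = blade p q C ∨ blade p q A * blade p q B = -blade p q C := by
  have : ∀ l : List (Fin (p + q)), ∃ C, (l.map (gen p q)).prod * blade p q B = blade p q C ∨
      (l.map (gen p q)).prod * blade p q B = -blade p q C := fun l => by
    induction l with
    | nil => exact ⟨B, by simp⟩
    | cons a l ih =>
      obtain ⟨C, hC⟩ := ih
      obtain ⟨D, hD⟩ := exists_gen_mul_blade a C
      refine ⟨D, ?_⟩
      rw [List.map_cons, List.prod_cons, mul_assoc]
      rcases hC with h | h <;> rcases hD with h' | h' <;> simp [h, h']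
  exact this _

theorem exists_blade_mul_self (A : Finset (Fin (p + q))) :
    ∃ c : ℂ, c ≠ 0 ∧ blade p q A * blade p q A = algebraMap ℂ (Cl p q) c := by
  have : ∀ l : List (Fin (p + q)), ∃ c : ℂ, c ≠ 0 ∧
      (l.map (gen p q)).prod * (l.map (gen p q)).prod = algebraMap ℂ (Cl p q) c := fun l => by
    induction l with
    | nil => exact ⟨1, by simp⟩
    | cons a l ih =>
      obtain ⟨c, hc, h⟩ := ih
      refine ⟨eta p q a * ((-1 : ℂ) ^ (l.length + l.count a) * c), ?_, ?_⟩
      · have := eta_mul_self (p := p) (q := q) a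
        refine mul_ne_zero (left_ne_zero_of_mul_eq_one this) (mul_ne_zero (by simp) hc)
      · rw [List.map_cons, List.prod_cons]
        nth_rw 2 [gen_mul_prod]
        rw [mul_smul_comm, mul_assoc, ← mul_assoc _ _ (gen p q a), h, Algebra.commutes,
          ← mul_assoc, gen_mul_self, map_mul, map_mul, Algebra.smul_def, ← map_mul, ← map_mul,
          ← map_mul, ← map_mul]
        ring_nf
  exact this _

/-! ### Conjugations in coordinates -/

theorem coeff_sum_smul_blade (f : Finset (Fin (p + q)) → ℂ) (A : Finset (Fin (p + q))) :
    coeff (∑ A, f A • blade p q A) A = f A := by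
  have h : ∑ A, f A • blade p q A = (bladeBasis p q).equivFun.symm f := by
    simp [Module.Basis.equivFun_symm_apply]
  rw [coeff, h, ← Module.Basis.equivFun_apply, LinearEquiv.apply_symm_apply]

theorem sum_rankPart (f : ℕ → ℂ) (U : Cl p q) :
    ∑ k ∈ Finset.range (p + q + 1), f k • rankPart k U
      = ∑ A, (f A.card * coeff U A) • blade p q A := by
  rw [← Finset.sum_fiberwise_of_maps_to (s := Finset.univ) (t := Finset.range (p + q + 1))
    (g := Finset.card)]
  · refine Finset.sum_congr rfl fun k _ => ?_
    rw [rankPart, Finset.smul_sum, ← Finset.powerset_univ, ← Finset.powersetCard_eq_filter]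
    refine Finset.sum_congr rfl fun A hA => ?_
    rw [(Finset.mem_powersetCard.mp hA).2, smul_smul]
  · intro A _
    simpa [Nat.lt_succ_iff] using A.card_le_univ

theorem coeff_rev (U : Cl p q) (A : Finset (Fin (p + q))) :
    coeff (rev U) A = (-1 : ℂ) ^ (A.card * (A.card - 1) / 2) * coeff U A := by
  rw [rev, sum_rankPart fun k => (-1 : ℂ) ^ (k * (k - 1) / 2), coeff_sum_smul_blade]

theorem coeff_gradeInv (U : Cl p q) (A : Finset (Fin (p + q))) :
    coeff (gradeInv U) A = (-1 : ℂ) ^ A.card * coeff U A := by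
  rw [gradeInv, sum_rankPart fun k => (-1 : ℂ) ^ k, coeff_sum_smul_blade]

theorem coeff_complexConj (U : Cl p q) (A : Finset (Fin (p + q))) :
    coeff (complexConj U) A = starRingEnd ℂ (coeff U A) := by
  rw [complexConj, coeff_sum_smul_blade]

theorem involute_prod (l : List (Fin (p + q))) :
    CliffordAlgebra.involute (l.map (gen p q)).prod
      = (-1 : ℂ) ^ l.length • (l.map (gen p q)).prod := by
  induction l with
  | nil => simp
  | cons a l ih =>
    rw [List.map_cons, List.prod_cons, map_mul, ih, gen, CliffordAlgebra.involute_ι,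
      List.length_cons, pow_succ]
    simp

theorem gradeInv_eq_involute (U : Cl p q) : gradeInv U = CliffordAlgebra.involute U := by
  conv_rhs => rw [← sum_coeff_smul_blade U]
  rw [gradeInv, sum_rankPart fun k => (-1 : ℂ) ^ k, map_sum]
  refine Finset.sum_congr rfl fun A _ => ?_
  rw [map_smul, blade, involute_prod, Finset.length_sort, smul_smul, mul_comm]

theorem reverse_prod (l : List (Fin (p + q))) (hl : l.Nodup) :
    CliffordAlgebra.reverse (l.map (gen p q)).prod
      = (-1 : ℂ) ^ (l.length * (l.length - 1) / 2) • (l.map (gen p q)).prod := by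
  induction l with
  | nil => simp
  | cons a l ih =>
    rw [List.nodup_cons] at hl
    -- Reversal puts `a` last; bringing it back to the front crosses `l.length` distinct generators.
    have hs : (l.length + 1) * (l.length + 1 - 1) / 2
        = l.length * (l.length - 1) / 2 + l.length := by
      rw [← Nat.choose_two_right, ← Nat.choose_two_right, Nat.choose_succ_succ' l.length 1,
        Nat.choose_one_right, add_comm]
    rw [List.map_cons, List.prod_cons, CliffordAlgebra.reverse.map_mul, ih hl.2,
      gen_mul_prod, List.count_eq_zero_of_not_mem hl.1, gen, CliffordAlgebra.reverse_ι, ← gen,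
      List.length_cons, hs, smul_mul_assoc, smul_smul, add_zero, pow_add, mul_assoc, ← pow_add,
      ← two_mul, pow_mul (-1) 2]
    simp

theorem rev_eq_reverse (U : Cl p q) : rev U = CliffordAlgebra.reverse U := by
  conv_rhs => rw [← sum_coeff_smul_blade U]
  rw [rev, sum_rankPart fun k => (-1 : ℂ) ^ (k * (k - 1) / 2), map_sum]
  refine Finset.sum_congr rfl fun A _ => ?_
  rw [map_smul, blade, reverse_prod _ (A.sort_nodup _), Finset.length_sort, smul_smul, mul_comm]

theorem coeff_blade (A B : Finset (Fin (p + q))) :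
    coeff (blade p q A) B = if A = B then 1 else 0 := by
  rw [coeff, ← bladeBasis_apply, Module.Basis.repr_self, Finsupp.single_apply]

theorem coeff_add (U V : Cl p q) (A : Finset (Fin (p + q))) :
    coeff (U + V) A = coeff U A + coeff V A := by simp [coeff]

theorem coeff_smul (c : ℂ) (U : Cl p q) (A : Finset (Fin (p + q))) :
    coeff (c • U) A = c * coeff U A := by simp [coeff]

theorem ext_coeff {U V : Cl p q} (h : ∀ A, coeff U A = coeff V A) : U = V := by
  rw [← sum_coeff_smul_blade U, ← sum_coeff_smul_blade V]
  simp only [h]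

theorem complexConj_add (U V : Cl p q) :
    complexConj (U + V) = complexConj U + complexConj V :=
  ext_coeff fun A => by simp only [coeff_complexConj, coeff_add, map_add]

theorem complexConj_smul (c : ℂ) (U : Cl p q) :
    complexConj (c • U) = starRingEnd ℂ c • complexConj U :=
  ext_coeff fun A => by simp only [coeff_complexConj, coeff_smul, map_mul]

theorem complexConj_blade (A : Finset (Fin (p + q))) :
    complexConj (blade p q A) = blade p q A :=
  ext_coeff fun B => by rw [coeff_complexConj, coeff_blade]; split_ifs <;> simp

theorem complexConj_neg (U : Cl p q) : complexConj (-U) = -complexConj U := by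
  rw [← neg_one_smul ℂ, complexConj_smul]; simp

theorem complexConj_blade_mul_blade (A B : Finset (Fin (p + q))) :
    complexConj (blade p q A * blade p q B) = blade p q A * blade p q B := by
  obtain ⟨C, h | h⟩ := exists_blade_mul_blade A B <;>
    simp only [h, complexConj_neg, complexConj_blade]

theorem blade_induction {P : Cl p q → Prop} (hb : ∀ A, P (blade p q A))
    (ha : ∀ U V, P U → P V → P (U + V)) (hs : ∀ (c : ℂ) U, P U → P (c • U)) (U : Cl p q) :
    P U := by
  rw [← sum_coeff_smul_blade U]
  refine Finset.sum_induction _ P ha ?_ fun A _ => hs _ _ (hb A)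
  simpa using hs 0 _ (hb ∅)

/-- The structure constants in the basis of products are `0` or `±1`, hence real. -/
theorem complexConj_mul (U V : Cl p q) :
    complexConj (U * V) = complexConj U * complexConj V := by
  induction U using blade_induction with
  | ha U₁ U₂ h₁ h₂ => rw [add_mul, complexConj_add, h₁, h₂, complexConj_add, add_mul]
  | hs c U h => rw [smul_mul_assoc, complexConj_smul, h, complexConj_smul, smul_mul_assoc]
  | hb A =>
    induction V using blade_induction with
    | ha U₁ U₂ h₁ h₂ => rw [mul_add, complexConj_add, h₁, h₂, complexConj_add, mul_add]
    | hs c U h => rw [mul_smul_comm, complexConj_smul, h, complexConj_smul, mul_smul_comm]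
    | hb B => rw [complexConj_blade_mul_blade, complexConj_blade, complexConj_blade]

theorem blade_empty : blade p q ∅ = 1 := by simp [blade]

theorem complexConj_pow (U : Cl p q) (k : ℕ) : complexConj (U ^ k) = complexConj U ^ k := by
  induction k with
  | zero => rw [pow_zero, pow_zero, ← blade_empty, complexConj_blade]
  | succ k ih => rw [pow_succ, complexConj_mul, ih, pow_succ]

theorem rev_pow (U : Cl p q) (k : ℕ) : rev (U ^ k) = rev U ^ k := by
  rw [rev_eq_reverse, rev_eq_reverse]
  induction k with
  | zero => simp
  | succ k ih => rw [pow_succ, CliffordAlgebra.reverse.map_mul, ih, pow_succ']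

theorem gradeInv_pow (U : Cl p q) (k : ℕ) : gradeInv (U ^ k) = gradeInv U ^ k := by
  rw [gradeInv_eq_involute, gradeInv_eq_involute, map_pow]

end CliffordDet
end

/-! ### Traces of the basis products and faithfulness -/

noncomputable section
namespace CliffordDet

open Matrix

variable {p q : ℕ} {ι : Type*} [Fintype ι] [DecidableEq ι]

theorem trace_eq_zero_of_anticommute {G M : Matrix ι ι ℂ} {c : ℂ} (hc : c ≠ 0)
    (hG : G * G = c • 1) (h : G * M = -(M * G)) : trace M = 0 := by
  have h1 : trace (G * M * G) = c * trace M := by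
    rw [trace_mul_comm, ← mul_assoc, hG]; simp
  have h2 : trace (G * M * G) = -(c * trace M) := by
    rw [h, neg_mul, mul_assoc, hG]; simp
  have : c * trace M = 0 := by linear_combination (h2 - h1) / 2
  exact (mul_eq_zero.mp this).resolve_left hc

theorem eta_ne_zero (a : Fin (p + q)) : eta p q a ≠ 0 :=
  left_ne_zero_of_mul_eq_one (eta_mul_self a)

theorem trace_blade_of_odd (γ : Cl p q →ₐ[ℂ] Matrix ι ι ℂ) {A : Finset (Fin (p + q))}
    {a : Fin (p + q)} (h : Odd (A.card + if a ∈ A then 1 else 0)) :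
    trace (γ (blade p q A)) = 0 := by
  refine trace_eq_zero_of_anticommute (G := γ (gen p q a)) (eta_ne_zero a) ?_ ?_
  · rw [← map_mul, gen_mul_self, AlgHom.commutes, Algebra.algebraMap_eq_smul_one]
  · rw [← map_mul, gen_mul_blade, h.neg_one_pow]; simp

/-- The trace in a representation, away from the central products, is a multiple of the
coefficient of the identity element. -/
theorem trace_eq_card_mul_coeff (γ : Cl p q →ₐ[ℂ] Matrix ι ι ℂ)
    (hω : Odd (p + q) → trace (γ (blade p q Finset.univ)) = 0) (U : Cl p q) :
    trace (γ U) = Fintype.card ι * coeff U ∅ := by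
  have hb : ∀ A, A ≠ ∅ → trace (γ (blade p q A)) = 0 := fun A hA => by
    -- An anticommuting generator is found inside `A` if `|A|` is even and outside `A` if `|A|` is
    -- odd. Only the full set of odd size has none.
    rcases Nat.even_or_odd A.card with he | ho
    · obtain ⟨a, ha⟩ := Finset.nonempty_iff_ne_empty.mpr hA
      exact trace_blade_of_odd γ (a := a) (by rw [if_pos ha]; exact he.add_one)
    · by_cases hu : A = Finset.univ
      · subst hu
        exact hω (by simpa using ho)
      · obtain ⟨a, ha⟩ : ∃ a, a ∉ A := by
          by_contra! h
          exact hu (Finset.eq_univ_iff_forall.mpr h)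
        exact trace_blade_of_odd γ (a := a) (by rw [if_neg ha]; exact ho)
  conv_lhs => rw [← sum_coeff_smul_blade U]
  rw [map_sum, trace_sum, Finset.sum_eq_single ∅]
  · rw [map_smul, blade_empty, map_one, trace_smul, trace_one, smul_eq_mul, mul_comm]
  · intro A _ hA
    rw [map_smul, trace_smul, hb A hA, smul_zero]
  · simp

theorem coeff_mul_blade_empty (U : Cl p q) (B : Finset (Fin (p + q))) :
    ∃ c : ℂ, c ≠ 0 ∧ coeff (U * blade p q B) ∅ = coeff U B * c := by
  obtain ⟨c, hc, hB⟩ := exists_blade_mul_self B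
  have h1 : ∀ d : ℂ, coeff (algebraMap ℂ (Cl p q) d) ∅ = d := fun d => by
    rw [Algebra.algebraMap_eq_smul_one, coeff_smul, ← blade_empty, coeff_blade, if_pos rfl, mul_one]
  refine ⟨c, hc, ?_⟩
  induction U using blade_induction with
  | ha U₁ U₂ h₁ h₂ => rw [add_mul, coeff_add, h₁, h₂, coeff_add, add_mul]
  | hs d U h => rw [smul_mul_assoc, coeff_smul, h, coeff_smul, mul_assoc]
  | hb A =>
    rw [coeff_blade]
    by_cases hAB : A = B
    · subst hAB
      rw [hB, h1, if_pos rfl, one_mul]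
    · rw [if_neg hAB, zero_mul]
      obtain ⟨C, hC⟩ := exists_blade_mul_blade A B
      by_cases hC0 : C = ∅
      · subst hC0
        -- If `e^A e^B = ±e`, then multiplying by `e^B` makes `e^A` a multiple of `e^B`, contrary to
        -- `A ≠ B`.
        exfalso
        have h2 : blade p q A * blade p q B * blade p q B = c • blade p q A := by
          rw [mul_assoc, hB, Algebra.smul_def, Algebra.commutes]
        have h3 := congrArg (coeff · A) h2
        simp only [coeff_smul, coeff_blade, if_true, mul_one] at h3
        rcases hC with h | h <;> rw [h, blade_empty] at h3
        · rw [one_mul, coeff_blade, if_neg (Ne.symm hAB)] at h3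
          exact hc h3.symm
        · rw [neg_one_mul, ← neg_one_smul ℂ, coeff_smul, coeff_blade, if_neg (Ne.symm hAB),
            mul_zero] at h3
          exact hc h3.symm
      · rcases hC with h | h <;> rw [h]
        · rw [coeff_blade, if_neg hC0]
        · rw [← neg_one_smul ℂ, coeff_smul, coeff_blade, if_neg hC0, mul_zero]

/-- If `γ U = 0`, then the trace of `γ (U e^B)` vanishes, and it is a nonzero multiple of the
coefficient of `e^B` in `U`. -/
theorem injective_of_trace [Nonempty ι] (γ : Cl p q →ₐ[ℂ] Matrix ι ι ℂ)
    (hω : Odd (p + q) → trace (γ (blade p q Finset.univ)) = 0) : Function.Injective γ := by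
  rw [injective_iff_map_eq_zero]
  refine fun U hU => ext_coeff fun B => ?_
  obtain ⟨c, hc, h⟩ := coeff_mul_blade_empty U B
  have ht := trace_eq_card_mul_coeff γ hω (U * blade p q B)
  rw [map_mul, hU, zero_mul, trace_zero, h] at ht
  have h0 : coeff (0 : Cl p q) B = 0 := by simp [coeff]
  rw [h0]
  simpa [hc] using ht.symm

/-! ### An explicit representation and the upper bound for the order -/

/-- Pairwise anticommuting matrices of order `2 ^ m` with square `1`, of which there are `2 m`. -/
theorem exists_anticommuting_matrices (m : ℕ) :
    ∃ (ι : Type) (_ : Fintype ι) (_ : DecidableEq ι) (g : ℕ → Matrix ι ι ℂ),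
      Fintype.card ι = 2 ^ m ∧ (∀ a < 2 * m, g a * g a = 1) ∧
      ∀ a < 2 * m, ∀ b < 2 * m, a ≠ b → g a * g b = -(g b * g a) := by
  induction m with
  | zero => exact ⟨Unit, inferInstance, inferInstance, 0, by simp⟩
  | succ m ih =>
    obtain ⟨ι, _, _, g, hι, hsq, hanti⟩ := ih
    -- With Pauli matrices, these are `σ_x ⊗ g a` and the two new matrices `σ_z ⊗ 1`, `σ_y ⊗ 1`.
    refine ⟨ι ⊕ ι, inferInstance, inferInstance, fun a =>
      if a < 2 * m then fromBlocks 0 (g a) (g a) 0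
      else if a = 2 * m then fromBlocks 1 0 0 (-1)
      else fromBlocks 0 (-(Complex.I • 1)) (Complex.I • 1) 0, ?_, ?_, ?_⟩
    · rw [Fintype.card_sum, hι, pow_succ]; ring
    · intro a _
      dsimp only
      split_ifs with h1 h2
      · simp [fromBlocks_multiply, hsq a h1]
      · simp [fromBlocks_multiply]
      · simp [fromBlocks_multiply, smul_smul]
    · intro a ha b hb hab
      dsimp only
      split_ifs with h1 h2 h3 h4 h5 h6 h7 h8
      all_goals first | omega | skip
      all_goals simp only [fromBlocks_multiply, fromBlocks_neg]
      all_goals congr 1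
      all_goals simp
      all_goals exact hanti a h1 b h2 hab

/-- `e^a` goes to `s a • g a` with `s a ^ 2 = η^{aa}`. A spare matrix `G`, present when `p + q < 2 *
m`, serves to kill the trace of `e^{1…n}` for odd `n`. -/
theorem exists_rep (m : ℕ) (h : p + q ≤ 2 * m) :
    ∃ (ι : Type) (_ : Fintype ι) (_ : DecidableEq ι) (γ : Cl p q →ₐ[ℂ] Matrix ι ι ℂ),
      Fintype.card ι = 2 ^ m ∧ (p + q < 2 * m → ∃ G : Matrix ι ι ℂ, G * G = 1 ∧
        ∀ a, G * γ (gen p q a) = -(γ (gen p q a) * G)) := by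
  obtain ⟨ι, _, _, g, hι, hsq, hanti⟩ := exists_anticommuting_matrices m
  obtain ⟨s, hs⟩ : ∃ s : Fin (p + q) → ℂ, ∀ a, s a * s a = eta p q a :=
    ⟨fun a => if (a : ℕ) < p then 1 else Complex.I, fun a => by
      unfold eta; dsimp only; split_ifs <;> simp⟩
  let f : (Fin (p + q) → ℂ) →ₗ[ℂ] Matrix ι ι ℂ :=
    ∑ a, (LinearMap.proj a).smulRight (s a • g a)
  have hf : ∀ v, f v = ∑ a, v a • s a • g a := fun v => by
    simp [f, LinearMap.sum_apply]
  have hff : ∀ v, f v * f v = algebraMap ℂ _ (form p q v) := fun v => by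
    have hswap : f v * f v + f v * f v = ∑ a, ∑ b,
        ((v a • s a • g a) * (v b • s b • g b) + (v b • s b • g b) * (v a • s a • g a)) := by
      simp only [Finset.sum_add_distrib]
      conv_rhs => rw [add_comm, Finset.sum_comm, add_comm]
      rw [hf, Finset.sum_mul_sum]
    have hterm : ∀ a b,
        (v a • s a • g a) * (v b • s b • g b) + (v b • s b • g b) * (v a • s a • g a)
          = if a = b then (2 * (eta p q a * (v a * v a))) • (1 : Matrix ι ι ℂ) else 0 := by
      intro a b
      split_ifs with hab
      · subst hab
        simp only [smul_mul_smul_comm, hsq a (by omega), ← hs]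
        rw [smul_smul, ← two_smul ℂ, smul_smul]
        congr 1
        ring
      · simp only [smul_mul_smul_comm]
        rw [hanti a (by omega) b (by omega) (fun h => hab (Fin.ext h))]
        rw [mul_comm (v b), mul_comm (s b)]
        simp
    have h2 : (2 : ℂ) • (f v * f v) = (2 : ℂ) • algebraMap ℂ (Matrix ι ι ℂ) (form p q v) := by
      rw [two_smul, hswap]
      simp only [hterm, Finset.sum_ite_eq, Finset.mem_univ, if_true]
      rw [form, QuadraticMap.weightedSumSquares_apply, Algebra.algebraMap_eq_smul_one,
        smul_smul, ← Finset.sum_smul, Finset.mul_sum]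
      rfl
    exact smul_right_injective _ (two_ne_zero' ℂ) h2
  refine ⟨ι, inferInstance, inferInstance, CliffordAlgebra.lift (form p q) ⟨f, hff⟩, hι,
    fun hlt => ⟨g (p + q), hsq _ hlt, fun a => ?_⟩⟩
  rw [gen, CliffordAlgebra.lift_ι_apply, hf, Finset.sum_eq_single a]
  · simp [hanti _ hlt a (by omega) (by omega)]
  · intro b _ hb; simp [hb]
  · simp

theorem minOrder_le : minOrder p q ≤ 2 ^ ((p + q + 1) / 2) := by
  classical
  obtain ⟨ι, _, _, γ, hι, hG⟩ := exists_rep (p := p) (q := q) ((p + q + 1) / 2) (by omega)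
  have : Nonempty ι := Fintype.card_pos_iff.mp (by rw [hι]; positivity)
  have hinj : Function.Injective γ := injective_of_trace γ fun hodd => by
    obtain ⟨G, hGG, hGa⟩ := hG (by obtain ⟨k, hk⟩ := hodd; omega)
    refine trace_eq_zero_of_anticommute (c := 1) (G := G) one_ne_zero (by simpa using hGG) ?_
    have hl : ∀ l : List (Fin (p + q)), G * γ (l.map (gen p q)).prod
        = (-1 : ℂ) ^ l.length • (γ (l.map (gen p q)).prod * G) := fun l => by
      induction l with
      | nil => simp
      | cons a l ih =>
        rw [List.map_cons, List.prod_cons, map_mul, ← mul_assoc, hGa, neg_mul, mul_assoc, ih,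
          List.length_cons, pow_succ, mul_smul_comm, mul_assoc]
        simp
    rw [blade, hl, Finset.length_sort, Finset.card_univ, Fintype.card_fin, hodd.neg_one_pow]
    simp
  refine Nat.find_min' _ ⟨((reindexAlgEquiv ℂ ℂ (Fintype.equivFinOfCardEq hι)).toAlgHom.comp γ), ?_⟩
  simpa using (reindexAlgEquiv ℂ ℂ (Fintype.equivFinOfCardEq hι)).injective.comp hinj

end CliffordDet
end

/-! ### The lower bound for the order and the minimal trace formula -/

noncomputable section
namespace CliffordDet

open Matrix

variable {p q : ℕ}

instance : FiniteDimensional ℂ (Cl p q) := Module.Basis.finiteDimensional_of_finite (bladeBasis p q)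

theorem finrank_cl : Module.finrank ℂ (Cl p q) = 2 ^ (p + q) := by
  rw [Module.finrank_eq_card_basis (bladeBasis p q), Fintype.card_finset, Fintype.card_fin]

/-- A central idempotent `e` cuts out a faithful representation of the ideal `Cl(p,q) e` on the
image of `e`. -/
theorem finrank_mulRight_le {V : Type*} [AddCommGroup V] [Module ℂ V] [FiniteDimensional ℂ V]
    (γ : Cl p q →ₐ[ℂ] Module.End ℂ V) (hγ : Function.Injective γ) {e : Cl p q}
    (hc : ∀ U, e * U = U * e) :
    Module.finrank ℂ (LinearMap.range (LinearMap.mulRight ℂ e))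
      ≤ Module.finrank ℂ (LinearMap.range (γ e)) ^ 2 := by
  have hinv : ∀ U, ∀ x ∈ LinearMap.range (γ e), γ U x ∈ LinearMap.range (γ e) := by
    rintro U _ ⟨x, rfl⟩
    exact ⟨γ U x, by rw [← Module.End.mul_apply, ← map_mul, hc, map_mul, Module.End.mul_apply]⟩
  let Φ : Cl p q →ₗ[ℂ] Module.End ℂ (LinearMap.range (γ e)) :=
    { toFun := fun U => (γ U).restrict (hinv U)
      map_add' := fun U W => by ext x; simp
      map_smul' := fun c U => by ext x; simp }
  -- If `U` acts as zero on the image of `γ e`, then `γ (U * e) = 0`, so `U * e = 0` by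
  -- faithfulness.
  have hker : LinearMap.ker Φ ≤ LinearMap.ker (LinearMap.mulRight ℂ e) := fun U hU => by
    rw [LinearMap.mem_ker] at hU ⊢
    rw [LinearMap.mulRight_apply]
    apply hγ
    rw [map_mul, map_zero]
    ext x
    have := congrArg Subtype.val (LinearMap.congr_fun hU ⟨γ e x, x, rfl⟩)
    simpa [Φ] using this
  have h1 := LinearMap.finrank_range_add_finrank_ker Φ
  have h2 := LinearMap.finrank_range_add_finrank_ker (LinearMap.mulRight ℂ e)
  have h3 := Submodule.finrank_mono hker
  have h4 := Submodule.finrank_le (LinearMap.range Φ)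
  rw [Module.finrank_linearMap, ← sq] at h4
  omega

/-- For odd `n` there is a central element with square `1`, proportional to `e^{1…n}`. -/
theorem exists_central_of_odd (h : Odd (p + q)) :
    ∃ ζ : ℂ, ζ ≠ 0 ∧
      (ζ • blade p q Finset.univ) * (ζ • blade p q Finset.univ) = 1 ∧
      ∀ U, (ζ • blade p q Finset.univ) * U = U * (ζ • blade p q Finset.univ) := by
  obtain ⟨c, hc, hsq⟩ := exists_blade_mul_self (p := p) (q := q) Finset.univ
  obtain ⟨ζ, hζ⟩ := IsAlgClosed.exists_pow_nat_eq c⁻¹ (n := 2) two_pos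
  have hζ0 : ζ ≠ 0 := by
    rintro rfl
    exact inv_ne_zero hc (by rw [← hζ]; simp)
  refine ⟨ζ, hζ0, ?_, fun U => ?_⟩
  · rw [smul_mul_smul_comm, hsq, ← sq, hζ, Algebra.smul_def, ← map_mul, inv_mul_cancel₀ hc, map_one]
  · rw [smul_mul_assoc, mul_smul_comm]
    congr 1
    have hgen : ∀ a, Commute (gen p q a) (blade p q Finset.univ) := fun a => by
      -- The sign is `(-1) ^ (n + 1) = 1` as `n` is odd.
      rw [Commute, SemiconjBy, gen_mul_blade, if_pos (Finset.mem_univ a), Finset.card_univ,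
        Fintype.card_fin, h.add_one.neg_one_pow, one_smul]
    induction U using blade_induction with
    | ha U₁ U₂ h₁ h₂ => rw [mul_add, add_mul, h₁, h₂]
    | hs d U h => rw [mul_smul_comm, smul_mul_assoc, h]
    | hb A =>
      refine (Commute.list_prod_left _ _ ?_ : Commute (blade p q A) _).symm
      intro x hx
      obtain ⟨a, _, rfl⟩ := List.mem_map.mp hx
      exact hgen a

/-- In a faithful representation for odd `n`, the two central idempotents have images of
dimension at least `2 ^ ((n - 1) / 2)`. -/
theorem exists_rank_of_odd {k N : ℕ} (hk : p + q = 2 * k + 1)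
    (γ : Cl p q →ₐ[ℂ] Matrix (Fin N) (Fin N) ℂ) (hγ : Function.Injective γ) :
    ∃ (ζ : ℂ) (r s : ℕ), ζ ≠ 0 ∧ 2 ^ k ≤ r ∧ 2 ^ k ≤ s ∧ N = r + s ∧
      ζ * trace (γ (blade p q Finset.univ)) = r - s := by
  have hodd : Odd (p + q) := ⟨k, hk⟩
  obtain ⟨ζ, hζ, hw, hc⟩ := exists_central_of_odd hodd
  have hinvol : CliffordAlgebra.involute (ζ • blade p q Finset.univ)
      = -(ζ • blade p q Finset.univ) := by
    rw [map_smul, blade, involute_prod, Finset.length_sort, Finset.card_univ, Fintype.card_fin,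
      hodd.neg_one_pow]
    simp
  have htr : trace (γ (ζ • blade p q Finset.univ)) = ζ * trace (γ (blade p q Finset.univ)) := by
    rw [map_smul, trace_smul, smul_eq_mul]
  suffices ∃ r s : ℕ, 2 ^ k ≤ r ∧ 2 ^ k ≤ s ∧ N = r + s ∧
      trace (γ (ζ • blade p q Finset.univ)) = r - s by
    obtain ⟨r, s, h⟩ := this
    exact ⟨ζ, r, s, hζ, by rwa [← htr]⟩
  clear htr
  generalize ζ • blade p q Finset.univ = w at hw hc hinvol
  let e₁ : Cl p q := (1 / 2 : ℂ) • (1 + w)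
  let e₂ : Cl p q := (1 / 2 : ℂ) • (1 - w)
  have hi₁ : e₁ * e₁ = e₁ := by
    simp only [e₁, smul_mul_smul_comm, mul_add, add_mul, one_mul, mul_one, hw]
    module
  have hi₂ : e₂ * e₂ = e₂ := by
    simp only [e₂, smul_mul_smul_comm, mul_sub, sub_mul, one_mul, mul_one, hw]
    module
  have hc₁ : ∀ U, e₁ * U = U * e₁ := fun U => by
    simp only [e₁, smul_mul_assoc, mul_smul_comm, add_mul, mul_add, hc, one_mul, mul_one]
  have hc₂ : ∀ U, e₂ * U = U * e₂ := fun U => by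
    simp only [e₂, smul_mul_assoc, mul_smul_comm, sub_mul, mul_sub, hc, one_mul, mul_one]
  have hsum : e₁ + e₂ = 1 := by simp only [e₁, e₂]; module
  have hinv₁ : CliffordAlgebra.involute e₁ = e₂ := by
    simp only [e₁, e₂, map_smul, map_add, map_one, hinvol, sub_eq_add_neg]
  let R₁ := LinearMap.range (LinearMap.mulRight ℂ e₁)
  let R₂ := LinearMap.range (LinearMap.mulRight ℂ e₂)
  -- The grade involution sends `w` to `-w`, hence exchanges `e₁` and `e₂` and the two ideals. Each
  -- thus has at least half the dimension, `2 ^ (2 * k)`.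
  have hR : Module.finrank ℂ R₂ ≤ Module.finrank ℂ R₁ := by
    have hle : R₂ ≤ R₁.map (CliffordAlgebra.involute (Q := form p q)).toLinearMap := by
      rintro _ ⟨U, rfl⟩
      refine ⟨CliffordAlgebra.involute U * e₁, ⟨CliffordAlgebra.involute U, rfl⟩, ?_⟩
      simp [hinv₁]
    exact (Submodule.finrank_mono hle).trans (Submodule.finrank_map_le _ _)
  have hR' : Module.finrank ℂ R₁ ≤ Module.finrank ℂ R₂ := by
    have hle : R₁ ≤ R₂.map (CliffordAlgebra.involute (Q := form p q)).toLinearMap := by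
      rintro _ ⟨U, rfl⟩
      refine ⟨CliffordAlgebra.involute U * e₂, ⟨CliffordAlgebra.involute U, rfl⟩, ?_⟩
      simp [← hinv₁]
    exact (Submodule.finrank_mono hle).trans (Submodule.finrank_map_le _ _)
  have htop : R₁ ⊔ R₂ = ⊤ := by
    rw [eq_top_iff]
    intro U _
    refine Submodule.mem_sup.mpr ⟨U * e₁, ⟨U, rfl⟩, U * e₂, ⟨U, rfl⟩, ?_⟩
    rw [← mul_add, hsum, mul_one]
  have hdim : 2 ^ (p + q) ≤ Module.finrank ℂ R₁ + Module.finrank ℂ R₂ := by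
    rw [← finrank_cl, ← finrank_top, ← htop]
    exact Submodule.finrank_add_le_finrank_add_finrank _ _
  let δ : Cl p q →ₐ[ℂ] Module.End ℂ (Fin N → ℂ) :=
    (toLinAlgEquiv' : Matrix (Fin N) (Fin N) ℂ ≃ₐ[ℂ] _).toAlgHom.comp γ
  have hδ : Function.Injective δ := by
    simpa [δ] using (toLinAlgEquiv' : Matrix (Fin N) (Fin N) ℂ ≃ₐ[ℂ] _).injective.comp hγ
  have htrace : ∀ e : Cl p q, e * e = e →
      trace (γ e) = Module.finrank ℂ (LinearMap.range (δ e)) := fun e he => by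
    have h1 : IsIdempotentElem (δ e) := by rw [IsIdempotentElem, ← map_mul, he]
    rw [← (LinearMap.IsIdempotentElem.isProj_range _ h1).trace]
    exact (trace_toLin'_eq _).symm
  have hpow : (2 ^ k) ^ 2 * 2 = 2 ^ (p + q) := by rw [hk, ← pow_mul, pow_succ, mul_comm k]
  have hbound : ∀ r : ℕ, (2 ^ k) ^ 2 ≤ r ^ 2 → 2 ^ k ≤ r := fun r h =>
    (Nat.pow_le_pow_iff_left two_ne_zero).mp h
  have hr := finrank_mulRight_le δ hδ hc₁
  have hs := finrank_mulRight_le δ hδ hc₂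
  refine ⟨_, _, hbound _ (le_trans ?_ hr), hbound _ (le_trans ?_ hs), ?_, ?_⟩
  · change _ ≤ Module.finrank ℂ R₁
    omega
  · change _ ≤ Module.finrank ℂ R₂
    omega
  · have : (N : ℂ) = trace (γ e₁) + trace (γ e₂) := by
      rw [← trace_add, ← map_add, hsum, map_one, trace_one, Fintype.card_fin]
    rw [htrace _ hi₁, htrace _ hi₂] at this
    exact_mod_cast this
  · rw [← htrace _ hi₁, ← htrace _ hi₂, ← trace_sub, ← map_sub]
    congr 2
    simp only [e₁, e₂]
    module

theorem minOrder_eq : minOrder p q = 2 ^ ((p + q + 1) / 2) := by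
  refine le_antisymm minOrder_le ?_
  obtain ⟨γ, hγ⟩ := hasFaithfulRep_minOrder p q
  rcases Nat.even_or_odd' (p + q) with ⟨k, hk | hk⟩
  · have h := LinearMap.finrank_le_finrank_of_injective (f := γ.toLinearMap) hγ
    rw [finrank_cl, Module.finrank_matrix, Fintype.card_fin, Module.finrank_self, mul_one, ← sq, hk,
      mul_comm 2 k, pow_mul] at h
    rw [show (p + q + 1) / 2 = k by omega]
    exact (Nat.pow_le_pow_iff_left two_ne_zero).mp h
  · obtain ⟨_, r, s, _, hr, hs, hN, _⟩ := exists_rank_of_odd hk γ hγ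
    rw [show (p + q + 1) / 2 = k + 1 by omega, pow_succ, hN]
    omega

/-- The trace in a faithful representation of minimal order. -/
theorem trace_eq_minOrder_mul_coeff
    (γ : Cl p q →ₐ[ℂ] Matrix (Fin (minOrder p q)) (Fin (minOrder p q)) ℂ)
    (hγ : Function.Injective γ) (U : Cl p q) :
    trace (γ U) = minOrder p q * coeff U ∅ := by
  rw [trace_eq_card_mul_coeff γ ?_, Fintype.card_fin]
  rintro ⟨k, hk⟩
  obtain ⟨ζ, r, s, hζ, hr, hs, hN, ht⟩ := exists_rank_of_odd hk γ hγ
  rw [minOrder_eq, show (p + q + 1) / 2 = k + 1 by omega, pow_succ] at hN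
  -- At minimal order `r + s = 2 * 2 ^ k` while both are at least `2 ^ k`.
  have hrs : r = s := by omega
  rw [hrs, sub_self] at ht
  exact (mul_eq_zero.mp ht).resolve_left hζ

/-! ### Properties of the determinant -/

theorem minRep_injective : Function.Injective (minRep p q) :=
  (hasFaithfulRep_minOrder p q).choose_spec

theorem trace_minRep (U : Cl p q) : trace (minRep p q U) = minOrder p q * coeff U ∅ :=
  trace_eq_minOrder_mul_coeff _ minRep_injective U

theorem Det_eq_det (γ : Cl p q →ₐ[ℂ] Matrix (Fin (minOrder p q)) (Fin (minOrder p q)) ℂ)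
    (hγ : Function.Injective γ) (U : Cl p q) : Det U = (γ U).det :=
  det_eq_of_trace_pow_eq fun k => by
    rw [← map_pow, ← map_pow, trace_minRep, trace_eq_minOrder_mul_coeff γ hγ]

theorem Det_mul (U V : Cl p q) : Det (U * V) = Det U * Det V := by
  rw [Det, map_mul, det_mul, Det, Det]

theorem Det_one : Det (1 : Cl p q) = 1 := by rw [Det, map_one, det_one]

theorem isUnit_iff_Det_ne_zero (U : Cl p q) : IsUnit U ↔ Det U ≠ 0 := by
  constructor
  · intro h
    exact (h.map (minRep p q)).map detMonoidHom |>.ne_zero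
  · intro h
    have hu : IsUnit (minRep p q U) := (isUnit_iff_isUnit_det _).mpr (isUnit_iff_ne_zero.mpr h)
    -- The inverse matrix is not yet known to lie in the image of `minRep`. Injectivity makes `U`
    -- right regular, which suffices in a finite-dimensional algebra.
    have : IsArtinianRing (Cl p q) := IsArtinianRing.of_finite ℂ _
    rw [IsArtinianRing.isUnit_iff_isRightRegular]
    intro V W hVW
    apply minRep_injective
    have h2 := congrArg (minRep p q) hVW
    simp only [map_mul] at h2
    exact hu.mul_right_cancel h2

theorem Det_units_inv (U : (Cl p q)ˣ) : Det (↑U⁻¹ : Cl p q) = (Det (U : Cl p q))⁻¹ :=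
  eq_inv_of_mul_eq_one_left (by rw [← Det_mul, Units.inv_mul, Det_one])

theorem Det_units_conj (U : (Cl p q)ˣ) (V : Cl p q) :
    Det ((↑U⁻¹ : Cl p q) * V * (U : Cl p q)) = Det V := by
  rw [Det_mul, Det_mul, mul_comm, ← mul_assoc, ← Det_mul, Units.mul_inv, Det_one, one_mul]

theorem Det_gradeInv (U : Cl p q) : Det (gradeInv U) = Det U :=
  det_eq_of_trace_pow_eq fun k => by
    rw [← map_pow, ← map_pow, ← gradeInv_pow, trace_minRep, trace_minRep, coeff_gradeInv]
    simp

theorem Det_rev (U : Cl p q) : Det (rev U) = Det U :=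
  det_eq_of_trace_pow_eq fun k => by
    rw [← map_pow, ← map_pow, ← rev_pow, trace_minRep, trace_minRep, coeff_rev]
    simp

/-- The matrix of the conjugate of `U` is compared with the entrywise conjugate of the matrix of
`U`; they need not be equal, but their powers have equal traces. -/
theorem Det_complexConj (U : Cl p q) : Det (complexConj U) = starRingEnd ℂ (Det U) := by
  rw [Det, Det, RingHom.map_det]
  refine det_eq_of_trace_pow_eq fun k => ?_
  rw [← map_pow, ← map_pow, ← map_pow, ← complexConj_pow, trace_minRep, coeff_complexConj]
  have h : trace ((starRingEnd ℂ).mapMatrix (minRep p q (U ^ k)))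
      = starRingEnd ℂ (trace (minRep p q (U ^ k))) := by
    simp [trace]
  rw [h, trace_minRep, map_mul, map_natCast]

theorem Det_pseudoHermitianConj (U : Cl p q) :
    Det (pseudoHermitianConj U) = starRingEnd ℂ (Det U) := by
  rw [pseudoHermitianConj, Det_rev, Det_complexConj]

theorem Det_hermitianConj (U : Cl p q) : Det (hermitianConj U) = starRingEnd ℂ (Det U) := by
  obtain ⟨u, hu⟩ : IsUnit (posBlade p q) := isUnit_blade _
  rw [hermitianConj, ← hu, Ring.inverse_unit]
  split_ifs
  · rw [Det_units_conj, Det_pseudoHermitianConj]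
  · rw [Det_units_conj, Det_gradeInv, Det_pseudoHermitianConj]

end CliffordDet
end

open CliffordDet in
theorem mainTheorem5 (p q : ℕ) :
    (∀ γ : Cl p q →ₐ[ℂ] Matrix (Fin (minOrder p q)) (Fin (minOrder p q)) ℂ,
      Function.Injective γ → ∀ U : Cl p q, Det U = (γ U).det) ∧
    (∀ U V : Cl p q, Det (U * V) = Det U * Det V) ∧
    (∀ (α : ℂ) (U : Cl p q), Det (α • U) = α ^ (2 ^ ((p + q + 1) / 2)) * Det U) ∧
    (∀ U : Cl p q, IsUnit U ↔ Det U ≠ 0) ∧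
    (∀ U : (Cl p q)ˣ, Det (↑U⁻¹ : Cl p q) = (Det (U : Cl p q))⁻¹) ∧
    (∀ (U : (Cl p q)ˣ) (V : Cl p q), Det ((↑U⁻¹ : Cl p q) * V * (U : Cl p q)) = Det V) ∧
    (∀ U : Cl p q,
      Det U = Det (gradeInv U) ∧
      Det U = Det (rev U) ∧
      Det U = (starRingEnd ℂ) (Det (complexConj U)) ∧
      Det U = (starRingEnd ℂ) (Det (pseudoHermitianConj U)) ∧
      Det U = (starRingEnd ℂ) (Det (hermitianConj U))) := by
  refine ⟨Det_eq_det, Det_mul, fun α U => ?_, isUnit_iff_Det_ne_zero, Det_units_inv,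
    Det_units_conj, fun U => ⟨(Det_gradeInv U).symm, (Det_rev U).symm, ?_, ?_, ?_⟩⟩
  · rw [Det, map_smul, Matrix.det_smul, Fintype.card_fin, ← minOrder_eq, Det]
  · rw [Det_complexConj, Complex.conj_conj]
  · rw [Det_pseudoHermitianConj, Complex.conj_conj]
  · rw [Det_hermitianConj, Complex.conj_conj]
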